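/- Let $2\le k\le d$ and $n$ be natural numbers and let $\mathbb F$ be a finite field. Let $\Psi$ ($n\times d$) and $\hat\Psi$ ($d\times d$) be matrices over $\mathbb F$ such that every square submatrix of the stacked matrix $\begin{bmatrix}\Psi\\ \hat\Psi\end{bmatrix}$ is nonsingular. *PM-MBR code.* Let $B=\frac{k(k+1)}2+k(d-k)$. A codeword $X\in\mathbb F^B$ is written into the symmetric $d\times d$ message matrix $M$ whose entries $M_{i,j}=M_{j,i}$ with $i\le j$, $i\le k$ are the $B$ symbols of $X$, and whose entries with $i,j>k$ are $0$. Node $e\in\{1,\dots,n\}$ stores the $d$ symbols $\Psi_eM$, where $\Psi_e$ is the $e$-th row of $\Psi$. For $c\in\mathbb F^d$ and $i\in\{1,\dots,d\}$, the row vector of type $i$ with coefficients $c$ is the vector in $\mathbb F^B$ whose $b$-th entry is $c_j$ if $M_{i,j}=X_b$ for some $j$, and $0$ if the symbol $X_b$ does not occur in row $i$ of $M$. Let $G_e$ be the $d\times B$ matrix whose $i$-th row is the vector of type $i$ with coefficients $\Psi_e$, so that node $e$ stores $G_eX$. *Outer coset code.* Put $\theta_1=0$, $\theta_i=d-k+i$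 for $2\le i\le k-1$, $\theta_k=d-1$, and $\theta_i=1$ for $k+1\le i\le d$. Let $H$ be the matrix with $B_s=\sum_i\theta_i$ rows consisting, for every $i$ and every $1\le p\le\theta_i$, of the vector of type $i$ with the $p$-th row of $\hat\Psi$ as coefficients. A message $S=(S_1,\dots,S_{B_s})$, with $S_1,\dots,S_{B_s}$ independent and uniform over $\mathbb F$, is encoded as a uniformly random $X\in\mathbb F^B$ with $HX=S$. Then: 1. Such an $X$ exists for every message (that is, $H$ has full row rank), and the resulting scheme is weakly secure against every number $g\le d+k-4$ of guesses when an eavesdropper observes any single node: for every node $e$, with $E=\Psi_eM$ its content, for every set $\mathcal G\subseteq\{1,\dots,B_s\}$ with $|\mathcal G|\le g$ and every $i\in\{1,\dots,B_s\}\setminus\mathcal G$, one has $I(S_i;E\mid S_{\mathcal G})=0$, where $S_{\mathcal G}=(S_j)_{j\in\mathcal G}$. 2. Equivalently, in terms of ranks: for every node $e$ and every set $\mathcal G'$ of at most $d+k-3$ rows of $H$, the stacked matrix $\begin{bmatrix}H_{\mathcal G'}\\ G_e\end{bmatrix}$ has full row rank $|\mathcal G'|+d$, where $H_{\mathcal G'}$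 is the submatrix of $H$ formed by the rows in $\mathcal G'$. -/

import Mathlib

noncomputable section

namespace WeakSec

/-! ## Shannon information of finite random variables -/

/-- Shannon entropy (in nats) of the random variable `W` on the finite probability space
given by the probability mass function `μ`. -/
def entropy {Ω α : Type*} [Fintype α] (μ : PMF Ω) (W : Ω → α) : ℝ :=
  ∑ a, Real.negMulLog (μ.map W a).toReal

/-- Conditional mutual information
`I(X; Y | Z) = H(X, Z) + H(Y, Z) - H(X, Y, Z) - H(Z)`. -/
def condMutualInfo {Ω α β γ : Type*} [Fintype α] [Fintype β] [Fintype γ]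
    (μ : PMF Ω) (X : Ω → α) (Y : Ω → β) (Z : Ω → γ) : ℝ :=
  entropy μ (fun ω => (X ω, Z ω)) + entropy μ (fun ω => (Y ω, Z ω))
    - entropy μ (fun ω => (X ω, Y ω, Z ω)) - entropy μ Z

/-! ## Coset coding and weak security -/

/-- The coset encoder with parity-check matrix `H`: the message `s` is encoded as a uniformly
random element `x` of the coset `{x | H x = s}`. That all these cosets are nonempty is the
hypothesis `hH`. -/
def cosetEncode {F ρ β : Type*} [Field F] [Fintype F] [DecidableEq F] [Fintype ρ]
    [Fintype β] [DecidableEq β] (H : Matrix ρ β F) (hH : Function.Surjective H.mulVec)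
    (s : ρ → F) : PMF (β → F) :=
  PMF.uniformOfFinset (Finset.univ.filter fun x : β → F => H.mulVec x = s)
    ⟨(hH s).choose, by simpa using (hH s).choose_spec⟩

/-- The joint law of (message, codeword): the message symbols are independent and uniform over
`F`, and the codeword is the random coset encoding of the message. -/
def cosetLaw {F ρ β : Type*} [Field F] [Fintype F] [DecidableEq F] [Fintype ρ] [DecidableEq ρ]
    [Fintype β] [DecidableEq β] (H : Matrix ρ β F) (hH : Function.Surjective H.mulVec) :
    PMF ((ρ → F) × (β → F)) :=
  (PMF.uniformOfFintype (ρ → F)).bind fun s => (cosetEncode H hH s).map fun x => (s, x)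

/-- A system with message and codeword jointly distributed as `μ`, in which Eve sees the value
`obs x` of the codeword `x`, is weakly secure against `g` guesses: `I(S_i; E | S_G) = 0` for
all sets `G` of at most `g` message symbols and all message symbols `i` outside `G`. -/
def WeaklySecureAgainst {F ρ β ε : Type*} [Fintype F] [DecidableEq ρ] [Fintype ε]
    (μ : PMF ((ρ → F) × (β → F))) (obs : (β → F) → ε) (g : ℕ) : Prop :=
  ∀ G : Finset ρ, G.card ≤ g → ∀ i : ρ, i ∉ G →
    condMutualInfo μ (fun ω => ω.1 i) (fun ω => obs ω.2) (fun ω (j : G) => ω.1 j) = 0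

/-! ## Product-matrix MBR codes -/

/-- The `B = k(k+1)/2 + k(d-k)` positions of the code symbols: the entries of the message
matrix on or above the diagonal and in its first `k` rows. -/
abbrev Pos (k d : ℕ) : Type :=
  {b : Fin d × Fin d // b.1 ≤ b.2 ∧ b.1.val < k}

/-- The symbol in row `i` and column `j` of the symmetric message matrix: the one at position
`(min i j, max i j)`, or none in the zero block. -/
def symbolAt (k : ℕ) {d : ℕ} (i j : Fin d) : Option (Pos k d) :=
  if h : (min i j).val < k then some ⟨(min i j, max i j), min_le_max, h⟩ else none

/-- The message matrix `M = [M₁ M₂; M₂ᵀ 0]`, filled with the symbols `x`. -/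
def messageMatrix {F : Type*} [Field F] {k d : ℕ} (x : Pos k d → F) : Matrix (Fin d) (Fin d) F :=
  fun i j => (symbolAt k i j).elim 0 x

/-- The `d` symbols `Ψ_e M` stored on node `e`. -/
def nodeContent {F : Type*} [Field F] {n k d : ℕ} (Ψ : Matrix (Fin n) (Fin d) F) (e : Fin n)
    (x : Pos k d → F) : Fin d → F :=
  Matrix.vecMul (Ψ e) (messageMatrix x)

/-- The row vector of type `i` with coefficients `c`: its entry at the position `b` is `c j` if
the symbol `b` stands in row `i` and column `j` of the message matrix (there is at most one such
`j`), and `0` if the symbol `b` does not occur in row `i`. -/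
def typeRow {F : Type*} [Field F] (k : ℕ) {d : ℕ} (c : Fin d → F) (i : Fin d) : Pos k d → F :=
  fun b => ∑ j, if symbolAt k i j = some b then c j else 0

/-- The generator matrix `G_e` of node `e`; its `i`-th row is the vector of type `i` with
coefficients `Ψ_e`. -/
def nodeGenerator {F : Type*} [Field F] {n : ℕ} (k : ℕ) {d : ℕ} (Ψ : Matrix (Fin n) (Fin d) F)
    (e : Fin n) : Matrix (Fin d) (Pos k d) F :=
  fun i => typeRow k (Ψ e) i

/-! ## The parity-check matrix of the outer code -/

/-- The number `θ_i` of rows of type `i` in the parity-check matrix, for `i = 1, …, d`. -/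
def typeCard (k d i : ℕ) : ℕ :=
  if i = 1 then 0
  else if i < k then d + i - k
  else if i = k then d - 1
  else 1

theorem typeCard_le (k : ℕ) {d : ℕ} (i : Fin d) : typeCard k d (i.val + 1) ≤ d := by
  have := i.isLt
  unfold typeCard
  split_ifs <;> omega

/-- The rows of the parity-check matrix: pairs of a type `i` (counted from `0`) and an index
`p < θ_{i+1}`. -/
abbrev RowIdx (k d : ℕ) : Type :=
  Σ i : Fin d, Fin (typeCard k d (i.val + 1))

/-- The parity-check matrix `H`: its `p`-th row of type `i` has as coefficients the `p`-th row
of the coefficient matrix `Ψhat`. -/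
def parityCheck {F : Type*} [Field F] (k : ℕ) {d : ℕ} (Ψhat : Matrix (Fin d) (Fin d) F) :
    Matrix (RowIdx k d) (Pos k d) F :=
  fun r => typeRow k (Ψhat (Fin.castLE (typeCard_le k r.1) r.2)) r.1

/-- Every square submatrix of `A` is nonsingular. -/
def AllSquareSubmatricesNonsingular {F m n : Type*} [Field F] (A : Matrix m n F) : Prop :=
  ∀ (s : ℕ) (r : Fin s ↪ m) (c : Fin s ↪ n), (A.submatrix r c).det ≠ 0

end WeakSec

end

namespace WeakSec

/-! ## Entropies of linear images of a uniform vector -/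

/-! Security reduces to rank: the law is that of `(H x, x)` with `x` uniform, and a surjective
linear image of a uniform vector is uniform. If any `g + 1` rows of `H` and the rows of `G_e` are
jointly independent, all entropies involved are logarithms of cardinalities and the information
cancels.

For ranks, collect a relation among typed rows into a `d × d` matrix `C`, adding in row `i` the
weighted coefficient vectors of type `i`. Outside the zero block of `M`, the relation says exactly
that `C` is alternating (`collect_diag`, `collect_skew`), so a zero row forces zeros in the matching
column. Nonsingularity says that a nontrivial combination of `m` coefficient rows has fewer than `m`
zeros. For `H` alone this kills the types one after another. With `G_e` added, the nonzero rows of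
`C` would need at least `d + k - 2` parity checks in total (`mul_add_mul_lower_bound`), more than
are available. -/

theorem map_uniform_of_surjective {V W : Type*} [AddGroup V] [Fintype V] [AddGroup W] [Fintype W]
    (f : V →+ W) (hf : Function.Surjective f) :
    (PMF.uniformOfFintype V).map f = PMF.uniformOfFintype W := by
  classical
  have hconst : ∀ b, (PMF.uniformOfFintype V).map f b = (PMF.uniformOfFintype V).map f 0 := by
    intro b
    obtain ⟨x, rfl⟩ := hf b
    -- Translation by `x` carries the fibre over `0` to the fibre over `f x`.
    rw [PMF.map_apply, PMF.map_apply, ← (Equiv.addRight x).tsum_eq]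
    refine tsum_congr fun a => ?_
    simp [eq_comm]
  have hsum := ((PMF.uniformOfFintype V).map f).tsum_coe
  rw [tsum_fintype, Finset.sum_congr rfl fun b _ => hconst b, Finset.sum_const, nsmul_eq_mul,
    Finset.card_univ] at hsum
  ext b
  rw [hconst, PMF.uniformOfFintype_apply]
  exact ENNReal.eq_inv_of_mul_eq_one_left (by rwa [mul_comm])

theorem entropy_eq_log_card {Ω α : Type*} [Fintype α] [Nonempty α] (μ : PMF Ω) (W : Ω → α)
    (h : μ.map W = PMF.uniformOfFintype α) : entropy μ W = Real.log (Fintype.card α) := by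
  have hc : (Fintype.card α : ℝ) ≠ 0 := by exact_mod_cast Fintype.card_ne_zero
  simp [entropy, h, Real.negMulLog, hc]

/-- All fibres of `H` have the same size, so a uniform message followed by a uniform point of its
coset is a uniform codeword. -/
theorem cosetLaw_eq_map {F ρ β : Type*} [Field F] [Fintype F] [DecidableEq F] [Fintype ρ]
    [DecidableEq ρ] [Fintype β] [DecidableEq β] (H : Matrix ρ β F)
    (hH : Function.Surjective H.mulVec) :
    cosetLaw H hH = (PMF.uniformOfFintype (β → F)).map fun x => (H.mulVec x, x) := by
  ext ⟨s, x⟩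
  have hfib := congrArg (fun p => p s)
    (map_uniform_of_surjective H.mulVecLin.toAddMonoidHom hH)
  simp only [PMF.map_apply, PMF.uniformOfFintype_apply, tsum_fintype, LinearMap.toAddMonoidHom_coe,
    Matrix.mulVecLin_apply, Finset.sum_ite, Finset.sum_const_zero, add_zero, Finset.sum_const,
    nsmul_eq_mul] at hfib
  have hfil : (Finset.univ.filter fun x : β → F => H.mulVec x = s)
      = Finset.univ.filter fun x : β → F => s = H.mulVec x := by
    simp only [eq_comm]
  have hcard : ((Finset.univ.filter fun x : β → F => H.mulVec x = s).card : ENNReal) ≠ 0 := by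
    obtain ⟨y, hy⟩ := hH s
    simp only [ne_eq, Nat.cast_eq_zero, Finset.card_eq_zero]
    exact Finset.ne_empty_of_mem (a := y) (by simpa using hy)
  rw [cosetLaw, PMF.bind_apply, tsum_eq_single s, PMF.map_apply, PMF.map_apply, tsum_eq_single x,
    tsum_eq_single x]
  · have henc : cosetEncode H hH s x = if H.mulVec x = s then
        ((Finset.univ.filter fun x : β → F => H.mulVec x = s).card : ENNReal)⁻¹ else 0 := by
      refine (PMF.uniformOfFinset_apply _ x).trans ?_
      simp
    rw [henc]
    simp only [Prod.mk.injEq, and_true, if_true, PMF.uniformOfFintype_apply]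
    rw [← hfil] at hfib
    by_cases hx : H.mulVec x = s
    · simp only [hx, if_true]
      rw [← hfib, mul_comm, ← mul_assoc, ENNReal.inv_mul_cancel hcard (ENNReal.natCast_ne_top _),
        one_mul]
    · simp [hx, Ne.symm hx]
  · intro y hy
    simp [Ne.symm hy]
  · intro y hy
    simp [Ne.symm hy]
  · intro t ht
    simp [PMF.map_apply, Ne.symm ht]

theorem entropy_cosetLaw {F ρ β α : Type*} [Field F] [Fintype F] [DecidableEq F]
    [Fintype ρ] [DecidableEq ρ] [Fintype β] [DecidableEq β] [AddGroup α] [Fintype α]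
    (H : Matrix ρ β F) (hH : Function.Surjective H.mulVec) (W : (ρ → F) × (β → F) → α)
    (f : (β → F) →+ α) (hW : ∀ x, W (H.mulVec x, x) = f x) (hf : Function.Surjective f) :
    entropy (cosetLaw H hH) W = Real.log (Fintype.card α) := by
  refine entropy_eq_log_card _ _ ?_
  rw [cosetLaw_eq_map, PMF.map_comp, ← map_uniform_of_surjective f hf]
  congr 1
  funext x
  exact hW x

/-- The bound is `g + 1` because the attacked symbol `i` joins the guessed set. -/
theorem weaklySecureAgainst_of_surjective {F ρ β ε : Type*} [Field F] [Fintype F] [DecidableEq F]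
    [Fintype ρ] [DecidableEq ρ] [Fintype β] [DecidableEq β] [Fintype ε] [DecidableEq ε]
    (H : Matrix ρ β F) (hH : Function.Surjective H.mulVec) (K : Matrix ε β F) (g : ℕ)
    (hK : ∀ G : Finset ρ, G.card ≤ g + 1 → Function.Surjective
      (Matrix.fromRows (H.submatrix (fun r : G => r.val) id) K).mulVec) :
    WeaklySecureAgainst (cosetLaw H hH) K.mulVec g := by
  intro G hG i hi
  -- every prescribed observation and prescribed symbols at `G` and `i` occur together
  have hsurj : ∀ (s : F) (y : ε → F) (z : G → F), ∃ x : β → F,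
      H.mulVec x i = s ∧ K.mulVec x = y ∧ (fun j : G => H.mulVec x j) = z := by
    intro s y z
    obtain ⟨x, hx⟩ := hK (insert i G) (by rw [Finset.card_insert_of_notMem hi]; omega)
      (Sum.elim (fun r => if h : r.val ∈ G then z ⟨r, h⟩ else s) y)
    rw [Matrix.fromRows_mulVec] at hx
    refine ⟨x, ?_, ?_, ?_⟩
    · have := congrFun hx (Sum.inl ⟨i, Finset.mem_insert_self i G⟩)
      simpa [hi, Matrix.mulVec, dotProduct] using this
    · funext e
      simpa using congrFun hx (Sum.inr e)
    · funext j
      have := congrFun hx (Sum.inl ⟨j, Finset.mem_insert_of_mem j.2⟩)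
      simpa [Matrix.mulVec, dotProduct] using this
  let fi : (β → F) →+ F := (LinearMap.proj i ∘ₗ H.mulVecLin).toAddMonoidHom
  let fG : (β → F) →+ (G → F) :=
    (LinearMap.pi fun j : G => LinearMap.proj j.val ∘ₗ H.mulVecLin).toAddMonoidHom
  let fE : (β → F) →+ (ε → F) := K.mulVecLin.toAddMonoidHom
  have hiG : Function.Surjective (fi.prod fG) := fun ⟨s, z⟩ =>
    let ⟨x, h1, _, h3⟩ := hsurj s 0 z
    ⟨x, Prod.ext h1 h3⟩
  have hEG : Function.Surjective (fE.prod fG) := fun ⟨y, z⟩ =>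
    let ⟨x, _, h2, h3⟩ := hsurj 0 y z
    ⟨x, Prod.ext h2 h3⟩
  have hiEG : Function.Surjective (fi.prod (fE.prod fG)) := fun ⟨s, y, z⟩ =>
    let ⟨x, h1, h2, h3⟩ := hsurj s y z
    ⟨x, Prod.ext h1 (Prod.ext h2 h3)⟩
  have hGs : Function.Surjective fG := fun z =>
    let ⟨x, _, _, h3⟩ := hsurj 0 0 z
    ⟨x, h3⟩
  rw [condMutualInfo, entropy_cosetLaw H hH _ _ (fun _ => rfl) hiG,
    entropy_cosetLaw H hH _ _ (fun _ => rfl) hEG, entropy_cosetLaw H hH _ _ (fun _ => rfl) hiEG,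
    entropy_cosetLaw H hH _ _ (fun _ => rfl) hGs]
  have hF : (Fintype.card F : ℝ) ≠ 0 := by exact_mod_cast Fintype.card_ne_zero
  have hE : (Fintype.card (ε → F) : ℝ) ≠ 0 := by exact_mod_cast Fintype.card_ne_zero
  have hG' : (Fintype.card (G → F) : ℝ) ≠ 0 := by exact_mod_cast Fintype.card_ne_zero
  simp only [Fintype.card_prod, Nat.cast_mul]
  rw [Real.log_mul hF hG', Real.log_mul hE hG', Real.log_mul hF (mul_ne_zero hE hG'),
    Real.log_mul hE hG']
  ring

/-! ## Combinations of few rows have few zeros -/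

/-- Choosing `R.card` columns inside `Z` gives a square submatrix with the weights in its left
kernel. -/
theorem AllSquareSubmatricesNonsingular.coeff_eq_zero {F m n ι : Type*} [Field F]
    {A : Matrix m n F} (hA : AllSquareSubmatricesNonsingular A) {σ : ι → m} {R : Finset ι}
    (hσ : Set.InjOn σ R) {Z : Finset n} (hRZ : R.card ≤ Z.card) (v : ι → F)
    (hv : ∀ j ∈ Z, ∑ r ∈ R, v r * A (σ r) j = 0) : ∀ r ∈ R, v r = 0 := by
  classical
  obtain ⟨Z', hZ', hcard⟩ := Finset.exists_subset_card_eq hRZ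
  let e : Fin R.card ≃ R := R.equivFin.symm
  let f : Fin R.card ≃ Z' := (Z'.equivFinOfCardEq hcard).symm
  let er : Fin R.card ↪ m :=
    ⟨fun t => σ (e t), fun s t h => e.injective (Subtype.ext (hσ (e s).2 (e t).2 h))⟩
  let fc : Fin R.card ↪ n :=
    ⟨fun t => (f t).val, fun s t h => f.injective (Subtype.ext h)⟩
  have hzero := Matrix.eq_zero_of_vecMul_eq_zero (hA _ er fc) (v := fun t => v (e t)) (by
    funext t
    have h := hv (fc t) (hZ' (f t).2)
    rw [← Finset.sum_coe_sort, ← e.sum_comp] at h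
    exact h)
  intro r hr
  simpa using congrFun hzero (e.symm ⟨r, hr⟩)

/-! ## Linear relations between typed rows -/

theorem symbolAt_comm (k : ℕ) {d : ℕ} (i j : Fin d) : symbolAt k i j = symbolAt k j i := by
  simp only [symbolAt, min_comm, max_comm]

theorem symbolAt_eq_some {k d : ℕ} {i j : Fin d} {b : Pos k d} :
    symbolAt k i j = some b ↔
      (i = b.1.1 ∧ j = b.1.2) ∨ (i = b.1.2 ∧ j = b.1.1) := by
  obtain ⟨⟨p, q⟩, hpq, hp⟩ := b
  simp only at hpq hp ⊢
  unfold symbolAt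
  constructor
  · intro h
    split_ifs at h with hm
    simp only [Option.some.injEq, Subtype.mk.injEq, Prod.mk.injEq] at h
    rcases le_total i j with hij | hij
    · rw [min_eq_left hij, max_eq_right hij] at h; exact Or.inl h
    · rw [min_eq_right hij, max_eq_left hij] at h; exact Or.inr h.symm
  · rintro (⟨rfl, rfl⟩ | ⟨rfl, rfl⟩)
    · simp [min_eq_left hpq, max_eq_right hpq, hp]
    · simp [min_eq_right hpq, max_eq_left hpq, hp]

section Relations

variable {F ι : Type*} [Field F] [Fintype ι] {k d : ℕ}

/-- The coefficients collected in row `i` by a linear combination, with weights `v`, of rows of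
types `τ r` with coefficients `c r`. -/
def collect (τ : ι → Fin d) (c : ι → Fin d → F) (v : ι → F) (i j : Fin d) : F :=
  ∑ r with τ r = i, v r * c r j

theorem sum_typeRow_apply (τ : ι → Fin d) (c : ι → Fin d → F) (v : ι → F) (b : Pos k d) :
    ∑ r, v r * typeRow k (c r) (τ r) b =
      ∑ i, ∑ j, if symbolAt k i j = some b then collect τ c v i j else 0 := by
  have h1 : ∀ i j : Fin d, (if symbolAt k i j = some b then collect τ c v i j else 0) =
      ∑ r, if τ r = i then (if symbolAt k i j = some b then v r * c r j else 0) else 0 := by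
    intro i j
    rw [← Finset.sum_filter]
    split_ifs <;> simp [collect]
  simp only [h1]
  rw [Finset.sum_congr rfl fun i _ => Finset.sum_comm, Finset.sum_comm]
  refine Finset.sum_congr rfl fun r _ => ?_
  rw [Finset.sum_eq_single (τ r) (fun i _ hi => by simp [Ne.symm hi]) (by simp), typeRow,
    Finset.mul_sum]
  simp

variable {τ : ι → Fin d} {c : ι → Fin d → F} {v : ι → F}

/-- A diagonal symbol occupies a single cell of `M`, so its equation has one term; this holds in
characteristic 2 as well. -/
theorem collect_diag (h : ∀ b : Pos k d, ∑ r, v r * typeRow k (c r) (τ r) b = 0)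
    (i : Fin d) (hi : i.val < k) : collect τ c v i i = 0 := by
  have := h ⟨(i, i), le_rfl, hi⟩
  rw [sum_typeRow_apply] at this
  simp only [symbolAt_eq_some, or_self] at this
  rw [Finset.sum_eq_single i, Finset.sum_eq_single i] at this
  · simpa using this
  all_goals simp +contextual

/-- An off-diagonal symbol occupies exactly the two cells `(i, j)` and `(j, i)`. -/
theorem collect_skew (h : ∀ b : Pos k d, ∑ r, v r * typeRow k (c r) (τ r) b = 0)
    (i j : Fin d) (hi : i.val < k) : collect τ c v i j + collect τ c v j i = 0 := by
  rcases eq_or_ne i j with rfl | hij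
  · rw [collect_diag h i hi, add_zero]
  have key : ∀ p q : Fin d, p < q → p.val < k →
      collect τ c v p q + collect τ c v q p = 0 := by
    intro p q hpq hp
    have := h ⟨(p, q), hpq.le, hp⟩
    rw [sum_typeRow_apply] at this
    simp only [symbolAt_eq_some] at this
    rw [Fintype.sum_eq_add p q hpq.ne, Finset.sum_eq_single q, Finset.sum_eq_single p] at this
    · simpa using this
    all_goals simp +contextual [hpq.ne, hpq.ne']
  rcases lt_or_gt_of_ne hij with h1 | h1
  · exact key i j h1 hi
  · rw [add_comm]
    exact key j i h1 (lt_trans h1 hi)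

theorem collect_eq_zero_of_row_eq_zero
    (h : ∀ b : Pos k d, ∑ r, v r * typeRow k (c r) (τ r) b = 0) {i j : Fin d}
    (hij : i.val < k ∨ j.val < k) (hj : ∀ t, collect τ c v j t = 0) :
    collect τ c v i j = 0 := by
  rcases hij with hi | hi
  · simpa [hj] using collect_skew h i j hi
  · simpa [hj] using collect_skew h j i hi

end Relations

/-! ## The parity-check matrix has full row rank -/

section FullRank

variable {F m : Type*} [Field F] {k d : ℕ} {A : Matrix m (Fin d) F}

theorem weight_eq_zero_of_collect {ι : Type*} [Fintype ι]
    (hA : AllSquareSubmatricesNonsingular A) {τ : ι → Fin d} {σ : ι → m}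
    (hinj : ∀ r s, τ r = τ s → σ r = σ s → r = s) {v : ι → F} {i : Fin d} {Z : Finset (Fin d)}
    (hZ : (Finset.univ.filter fun r => τ r = i).card ≤ Z.card)
    (h : ∀ j ∈ Z, collect τ (fun r => A (σ r)) v i j = 0) : ∀ r, τ r = i → v r = 0 := by
  intro r hr
  refine hA.coeff_eq_zero (σ := σ) (R := Finset.univ.filter fun r => τ r = i) ?_ hZ v h r
    (by simp [hr])
  intro a ha b hb hab
  simp only [Finset.coe_filter, Finset.mem_univ, true_and, Set.mem_ofPred_eq] at ha hb
  exact hinj a b (ha.trans hb.symm) hab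

theorem collect_eq_zero_of_weight {ι : Type*} [Fintype ι] {τ : ι → Fin d} {c : ι → Fin d → F}
    {v : ι → F} {i : Fin d} (h : ∀ r, τ r = i → v r = 0) (j : Fin d) : collect τ c v i j = 0 :=
  Finset.sum_eq_zero fun r hr => by simp [h r (by simpa using hr)]

theorem card_typeRows (k : ℕ) {d : ℕ} (i : Fin d) :
    (Finset.univ.filter fun r : RowIdx k d => r.1 = i).card = typeCard k d (i.val + 1) := by
  classical
  have : (Finset.univ.filter fun r : RowIdx k d => r.1 = i) =
      Finset.univ.map (Function.Embedding.sigmaMk i) := by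
    ext ⟨j, p⟩
    simp only [Finset.mem_filter, Finset.mem_univ, true_and, Finset.mem_map,
      Function.Embedding.sigmaMk_apply]
    constructor
    · rintro rfl
      exact ⟨p, rfl⟩
    · rintro ⟨q, hq⟩
      exact (congrArg Sigma.fst hq).symm
  rw [this, Finset.card_map, Finset.card_univ, Fintype.card_fin]

theorem card_filter_val {d : ℕ} (p : ℕ → Prop) [DecidablePred p] :
    (Finset.univ.filter fun j : Fin d => p j.val).card = ((Finset.range d).filter p).card := by
  rw [Finset.card_filter, Finset.card_filter]
  exact Fin.sum_univ_eq_sum_range (fun j => if p j then 1 else 0) d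

theorem card_lt_or_ge {k d : ℕ} (hkd : k ≤ d) {i : ℕ} (hi : i < k) :
    (Finset.univ.filter fun j : Fin d => j.val ≤ i ∨ k ≤ j.val).card = i + 1 + (d - k) := by
  rw [card_filter_val fun j => j ≤ i ∨ k ≤ j]
  have : ((Finset.range d).filter fun j => j ≤ i ∨ k ≤ j) =
      Finset.range (i + 1) ∪ Finset.Ico k d := by
    ext j
    simp only [Finset.mem_filter, Finset.mem_range, Finset.mem_union, Finset.mem_Ico]
    omega
  rw [this, Finset.card_union_of_disjoint, Finset.card_range, Nat.card_Ico]
  rw [Finset.disjoint_left]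
  intro j h1 h2
  simp only [Finset.mem_range, Finset.mem_Ico] at h1 h2
  omega

theorem card_filter_val_lt {k d : ℕ} (hkd : k ≤ d) :
    (Finset.univ.filter fun j : Fin d => j.val < k).card = k := by
  rw [card_filter_val fun j => j < k]
  have : ((Finset.range d).filter fun j => j < k) = Finset.range k := by
    ext j
    simp only [Finset.mem_filter, Finset.mem_range]
    omega
  rw [this, Finset.card_range]

theorem card_filter_le_val {k d : ℕ} :
    (Finset.univ.filter fun j : Fin d => k ≤ j.val).card = d - k := by
  rw [card_filter_val fun j => k ≤ j]
  have : ((Finset.range d).filter fun j => k ≤ j) = Finset.Ico k d := by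
    ext j
    simp only [Finset.mem_filter, Finset.mem_range, Finset.mem_Ico]
    omega
  rw [this, Nat.card_Ico]

theorem linearIndependent_parityCheck {n : ℕ} (hk : 2 ≤ k) (hkd : k ≤ d)
    {Ψ : Matrix (Fin n) (Fin d) F} {Ψhat : Matrix (Fin d) (Fin d) F}
    (hΨ : AllSquareSubmatricesNonsingular (Matrix.fromRows Ψ Ψhat)) :
    LinearIndependent F (parityCheck k Ψhat).row := by
  refine Fintype.linearIndependent_iff.2 fun v hv => ?_
  set τ : RowIdx k d → Fin d := fun r => r.1
  set σ : RowIdx k d → Fin n ⊕ Fin d := fun r => Sum.inr (Fin.castLE (typeCard_le k r.1) r.2)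
  have hinj : ∀ r s, τ r = τ s → σ r = σ s → r = s := by
    rintro ⟨i, p⟩ ⟨j, q⟩ h1 h2
    obtain rfl : i = j := h1
    have : p = q := Fin.castLE_injective _ (Sum.inr_injective h2)
    rw [this]
  have hrel : ∀ b : Pos k d,
      ∑ r, v r * typeRow k (Matrix.fromRows Ψ Ψhat (σ r)) (τ r) b = 0 := by
    intro b
    have := congrFun hv b
    rw [Finset.sum_apply] at this
    exact this
  have hstep : ∀ (i : Fin d) (Z : Finset (Fin d)), typeCard k d (i.val + 1) ≤ Z.card →
      (∀ j ∈ Z, collect τ (fun r => Matrix.fromRows Ψ Ψhat (σ r)) v i j = 0) →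
      ∀ r, τ r = i → v r = 0 := fun i Z hZ h =>
    weight_eq_zero_of_collect hΨ hinj ((card_typeRows k i).trans_le hZ) h
  let z : Fin d := ⟨0, by omega⟩
  -- The first type has no rows, as `θ_1 = 0`.
  have h0 : ∀ r, τ r = z → v r = 0 :=
    hstep z ∅ (by simp [typeCard, z]) (by simp)
  have hcol0 : ∀ i, collect τ (fun r => Matrix.fromRows Ψ Ψhat (σ r)) v i z = 0 := fun i =>
    collect_eq_zero_of_row_eq_zero hrel (Or.inr (by simp [z]; omega)) (collect_eq_zero_of_weight h0)
  -- Here `θ = 1`, so the single zero in column `z` suffices.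
  have hlarge : ∀ i : Fin d, k ≤ i.val → ∀ r, τ r = i → v r = 0 := by
    intro i hi
    refine hstep i {z} ?_ (by simpa using hcol0 i)
    unfold typeCard
    rw [Finset.card_singleton]
    split_ifs <;> omega
  have hsmall : ∀ (t : ℕ) (i : Fin d), i.val = t → i.val < k → ∀ r, τ r = i → v r = 0 := by
    intro t
    induction t using Nat.strong_induction_on with
    | _ t ih =>
      intro i hit hik
      -- Zeros come from the diagonal, the earlier types and the types from `k` on: at least `θ` of
      -- them.
      refine hstep i (Finset.univ.filter fun j : Fin d => j.val ≤ i ∨ k ≤ j.val) ?_ ?_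
      · rw [card_lt_or_ge hkd hik]
        unfold typeCard
        split_ifs <;> omega
      · intro j hj
        rcases eq_or_ne j i with rfl | hne
        · exact collect_diag hrel _ hik
        refine collect_eq_zero_of_row_eq_zero hrel (Or.inl hik) (collect_eq_zero_of_weight ?_)
        have hne' : j.val ≠ i.val := fun h => hne (Fin.ext h)
        rcases (Finset.mem_filter.1 hj).2 with h | h
        · exact ih j.val (by omega) j rfl (by omega)
        · exact hlarge j h
  intro r
  rcases lt_or_ge (τ r).val k with h | h
  · exact hsmall _ _ rfl h r rfl
  · exact hlarge _ h r rfl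

theorem mulVec_surjective_of_linearIndependent {ρ β : Type*} [Fintype ρ] [Fintype β]
    {M : Matrix ρ β F} (hM : LinearIndependent F M.row) : Function.Surjective M.mulVec := by
  have hr := hM.rank_matrix
  have : LinearMap.range M.mulVecLin = ⊤ :=
    Submodule.eq_top_of_finrank_eq (by rw [Module.finrank_fintype_fun_eq_card]; exact hr)
  exact LinearMap.range_eq_top.1 this

/-! ## Few parity checks together with one node -/

/-- Here `s` and `m` count the nonzero rows of `C` with index below `k` and from `k` on. Either `m =
0` and `2 ≤ s < k`, or `s = k - 1`. -/
theorem mul_add_mul_lower_bound {k d s m : ℕ} (hk : 2 ≤ k) (hkd : k ≤ d) (hm : m ≤ d - k)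
    (hs : s < k) (hs1 : s = 1 → 0 < m) (hpos : 0 < s + m) (hms : 0 < m → s + 1 = k) :
    d + k - 2 ≤ s * (1 + d - (s + m)) + m * (k - s) := by
  rcases Nat.eq_zero_or_pos m with rfl | hm0
  · obtain ⟨t, rfl⟩ : ∃ t, s = t + 2 := ⟨s - 2, by omega⟩
    obtain ⟨a, rfl⟩ : ∃ a, k = t + 2 + 1 + a := Nat.exists_eq_add_of_lt hs |>.imp fun _ h => by omega
    obtain ⟨b, rfl⟩ := Nat.exists_eq_add_of_le hkd
    have : 1 + (t + 2 + 1 + a + b) - (t + 2 + 0) = 2 + a + b := by omega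
    rw [this]
    have : t + 2 + 1 + a + b + (t + 2 + 1 + a) - 2 = 2 * t + 4 + 2 * a + b := by omega
    rw [this]
    nlinarith [Nat.zero_le (t * (a + b)), Nat.zero_le b]
  · obtain rfl := hms hm0
    obtain ⟨f, hf⟩ := Nat.exists_eq_add_of_le hm
    obtain rfl : d = s + 1 + m + f := by omega
    obtain ⟨t, rfl⟩ : ∃ t, s = t + 1 := ⟨s - 1, by omega⟩
    have : 1 + (t + 1 + 1 + m + f) - (t + 1 + m) = 2 + f := by omega
    rw [this, Nat.add_sub_cancel_left]
    have : t + 1 + 1 + m + f + (t + 1 + 1) - 2 = 2 * t + 2 + m + f := by omega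
    rw [this]
    nlinarith [Nat.zero_le (t * f)]

theorem linearIndependent_parityCheck_nodeGenerator {n : ℕ} (hk : 2 ≤ k) (hkd : k ≤ d)
    {Ψ : Matrix (Fin n) (Fin d) F} {Ψhat : Matrix (Fin d) (Fin d) F}
    (hΨ : AllSquareSubmatricesNonsingular (Matrix.fromRows Ψ Ψhat)) (e : Fin n)
    (G : Finset (RowIdx k d)) (hG : G.card ≤ d + k - 3) :
    LinearIndependent F (Matrix.fromRows
      ((parityCheck k Ψhat).submatrix (fun r : G => r.val) id) (nodeGenerator k Ψ e)).row := by
  classical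
  refine Fintype.linearIndependent_iff.2 fun v hv => ?_
  set τ : G ⊕ Fin d → Fin d := Sum.elim (fun r => r.val.1) id with hτ
  set σ : G ⊕ Fin d → Fin n ⊕ Fin d :=
    Sum.elim (fun r => Sum.inr (Fin.castLE (typeCard_le k r.val.1) r.val.2)) fun _ => Sum.inl e
    with hσ
  have hinj : ∀ r s, τ r = τ s → σ r = σ s → r = s := by
    rintro (⟨⟨i, p⟩, hp⟩ | i) (⟨⟨j, q⟩, hq⟩ | j) h1 h2
    · obtain rfl : i = j := h1
      have : p = q := Fin.castLE_injective _ (Sum.inr_injective h2)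
      subst this
      rfl
    · simp [hσ] at h2
    · simp [hσ] at h2
    · exact congrArg Sum.inr h1
  have hrel : ∀ b : Pos k d,
      ∑ r, v r * typeRow k (Matrix.fromRows Ψ Ψhat (σ r)) (τ r) b = 0 := by
    intro b
    have := congrFun hv b
    rw [Finset.sum_apply] at this
    refine (Finset.sum_congr rfl ?_).trans this
    rintro (r | r) _ <;> rfl
  set C := collect τ (fun r => Matrix.fromRows Ψ Ψhat (σ r)) v
  let γ : Fin d → ℕ := fun i => (G.filter fun r => r.1 = i).card
  have hγθ : ∀ i, γ i ≤ typeCard k d (i.val + 1) := fun i =>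
    (Finset.card_le_card (Finset.filter_subset_filter _ (Finset.subset_univ _))).trans_eq
      (card_typeRows k i)
  have hγd : ∀ i, γ i ≤ d - 1 := by
    intro i
    refine (hγθ i).trans ?_
    unfold typeCard
    split_ifs <;> omega
  have hγsum : ∑ i, γ i = G.card :=
    (Finset.card_eq_sum_card_fiberwise fun _ _ => Finset.mem_coe.2 (Finset.mem_univ _)).symm
  -- The extra row is the node's own row of type `i`.
  have hcard : ∀ i, (Finset.univ.filter fun r => τ r = i).card = γ i + 1 := by
    intro i
    rw [Finset.card_filter, Fintype.sum_sum_type, ← Finset.card_filter, ← Finset.card_filter]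
    congr 1
    · rw [← Finset.card_map (Function.Embedding.subtype _)]
      congr 1
      ext r
      suffices (∃ x, (⟨i, x⟩ : RowIdx k d) = r ∧ ⟨i, x⟩ ∈ G) ↔ r.1 = i ∧ r ∈ G by
        simpa [hτ, and_comm] using this
      constructor
      · rintro ⟨x, rfl, hx⟩
        exact ⟨rfl, hx⟩
      · rintro ⟨rfl, hr⟩
        exact ⟨r.2, rfl, hr⟩
    · simp [hτ, Finset.filter_eq']
  -- a nonzero row has at most `γ i` zeros
  have hzeros : ∀ (i : Fin d) (Z : Finset (Fin d)), (∃ r, τ r = i ∧ v r ≠ 0) →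
      (∀ j ∈ Z, C i j = 0) → Z.card ≤ γ i := by
    rintro i Z ⟨r, hr, hvr⟩ hZ
    by_contra! hlt
    exact hvr (weight_eq_zero_of_collect hΨ hinj ((hcard i).trans_le hlt) hZ r hr)
  let P : Fin d → Prop := fun i => ∃ r, τ r = i ∧ v r ≠ 0
  have hnot : ∀ j, ¬ P j → ∀ t, C j t = 0 := fun j hj =>
    collect_eq_zero_of_weight fun r hr => by_contra fun h => hj ⟨r, hr, h⟩
  let N₁ := Finset.univ.filter fun i : Fin d => i.val < k ∧ P i
  let N₂ := Finset.univ.filter fun i : Fin d => k ≤ i.val ∧ P i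
  let z : Fin d := ⟨0, by omega⟩
  have hdisj : Disjoint N₁ N₂ := by
    rw [Finset.disjoint_left]
    intro i h1 h2
    simp only [N₁, N₂, Finset.mem_filter] at h1 h2
    omega
  have hN : N₁ ∪ N₂ = Finset.univ.filter P := by
    ext i
    simp only [N₁, N₂, Finset.mem_union, Finset.mem_filter, Finset.mem_univ, true_and]
    rw [← or_and_right, and_iff_right (lt_or_ge i.val k)]
  -- One zero on the diagonal and one for each zero row of `C`.
  have hbound₁ : ∀ i ∈ N₁, 1 + d - (N₁.card + N₂.card) ≤ γ i := by
    intro i hi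
    obtain ⟨hik, hPi⟩ := (Finset.mem_filter.1 hi).2
    have := hzeros i (insert i (Finset.univ.filter P)ᶜ) hPi (by
      intro j hj
      rcases Finset.mem_insert.1 hj with rfl | hj
      · exact collect_diag hrel _ hik
      · exact collect_eq_zero_of_row_eq_zero hrel (Or.inl hik) (hnot j (by simpa using hj)))
    rw [Finset.card_insert_of_notMem (by simpa using hPi), Finset.card_compl, Fintype.card_fin,
      ← hN, Finset.card_union_of_disjoint hdisj] at this
    omega
  have hksplit : (Finset.univ.filter fun j : Fin d => j.val < k ∧ ¬ P j).card = k - N₁.card := by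
    have h1 : (Finset.univ.filter fun j : Fin d => j.val < k).card = k := card_filter_val_lt hkd
    have h2 := Finset.card_filter_add_card_filter_not
      (s := Finset.univ.filter fun j : Fin d => j.val < k) P
    rw [Finset.filter_filter, Finset.filter_filter, h1] at h2
    change N₁.card + _ = k at h2
    omega
  -- Only columns below `k` count, since the zero block imposes no relation.
  have hbound₂ : ∀ i ∈ N₂, k - N₁.card ≤ γ i := by
    intro i hi
    rw [← hksplit]
    refine hzeros i _ (Finset.mem_filter.1 hi).2.2 fun j hj => ?_
    obtain ⟨hjk, hPj⟩ := (Finset.mem_filter.1 hj).2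
    exact collect_eq_zero_of_row_eq_zero hrel (Or.inr hjk) (hnot j hPj)
  have hγ0 : γ z = 0 := by
    have := hγθ z
    simpa [typeCard, z] using this
  -- Row `z` contains only the node's row, which the diagonal zero already kills.
  have hz : ¬ P z := by
    intro h
    have := hzeros z {z} h (by simpa using collect_diag hrel z (by simp [z]; omega))
    simp [hγ0] at this
  have hN₁ : N₁.card < k := by
    have : 0 < (Finset.univ.filter fun j : Fin d => j.val < k ∧ ¬ P j).card :=
      Finset.card_pos.2 ⟨z, by simp [hz]; simp [z]; omega⟩
    omega
  have hN₂ : N₂.card ≤ d - k := by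
    rw [← card_filter_le_val]
    exact Finset.card_le_card fun i hi => by
      simp only [N₂, Finset.mem_filter, Finset.mem_univ, true_and] at hi ⊢
      exact hi.1
  -- `θ = 1` beyond `k` forces `k - N₁.card ≤ 1`.
  have hN₂pos : 0 < N₂.card → N₁.card + 1 = k := by
    intro h
    obtain ⟨i, hi⟩ := Finset.card_pos.1 h
    have h1 := (hbound₂ i hi).trans (hγθ i)
    have h2 : k ≤ i.val := (Finset.mem_filter.1 hi).2.1
    unfold typeCard at h1
    split_ifs at h1 <;> omega
  by_cases hempty : N₁.card + N₂.card = 0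
  · intro r
    by_contra hr
    have : τ r ∈ N₁ ∪ N₂ := by rw [hN]; simpa using ⟨r, rfl, hr⟩
    rw [← Finset.card_union_of_disjoint hdisj] at hempty
    simp [Finset.card_eq_zero.1 hempty] at this
  exfalso
  have hsum : N₁.card * (1 + d - (N₁.card + N₂.card)) + N₂.card * (k - N₁.card) ≤ G.card := by
    rw [← hγsum, ← smul_eq_mul, ← smul_eq_mul]
    refine le_trans (add_le_add (Finset.card_nsmul_le_sum _ _ _ hbound₁)
      (Finset.card_nsmul_le_sum _ _ _ hbound₂)) ?_
    rw [← Finset.sum_union hdisj]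
    exact Finset.sum_le_sum_of_subset (Finset.subset_univ _)
  -- A lone nonzero row would have `d` zeros, but `γ i ≤ d - 1`.
  have hone : N₁.card = 1 → 0 < N₂.card := by
    intro hone
    by_contra h2
    obtain ⟨i, hi⟩ := Finset.card_pos.1 (hone ▸ one_pos : 0 < N₁.card)
    have h3 := (hbound₁ i hi).trans (hγd i)
    omega
  have := mul_add_mul_lower_bound hk hkd hN₂ hN₁ hone (Nat.pos_of_ne_zero hempty) hN₂pos
  omega

end FullRank

/-! ## Node contents as linear images of the codeword -/

theorem messageMatrix_comm {F : Type*} [Field F] {k d : ℕ} (x : Pos k d → F) (i j : Fin d) :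
    messageMatrix x i j = messageMatrix x j i := by
  rw [messageMatrix, messageMatrix, symbolAt_comm]

theorem nodeContent_eq_mulVec {F : Type*} [Field F] {n k d : ℕ} (Ψ : Matrix (Fin n) (Fin d) F)
    (e : Fin n) : nodeContent (k := k) Ψ e = (nodeGenerator k Ψ e).mulVec := by
  funext x i
  simp only [nodeContent, Matrix.vecMul, Matrix.mulVec, dotProduct, nodeGenerator, typeRow,
    Finset.sum_mul]
  rw [Finset.sum_comm]
  refine Finset.sum_congr rfl fun j _ => ?_
  rw [messageMatrix_comm, messageMatrix]
  cases symbolAt k i j <;> simp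

end WeakSec

theorem theorem2 {F : Type*} [Field F] [Fintype F] [DecidableEq F]
    (n k d : ℕ) (hk : 2 ≤ k) (hkd : k ≤ d)
    (Ψ : Matrix (Fin n) (Fin d) F) (Ψhat : Matrix (Fin d) (Fin d) F)
    (hΨ : WeakSec.AllSquareSubmatricesNonsingular (Matrix.fromRows Ψ Ψhat)) :
    (∃ hH : Function.Surjective (WeakSec.parityCheck k Ψhat).mulVec,
      ∀ g : ℕ, g ≤ d + k - 4 → ∀ e : Fin n,
        WeakSec.WeaklySecureAgainst (WeakSec.cosetLaw (WeakSec.parityCheck k Ψhat) hH)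
          (WeakSec.nodeContent Ψ e) g) ∧
    (∀ (e : Fin n) (G' : Finset (WeakSec.RowIdx k d)), G'.card ≤ d + k - 3 →
      (Matrix.fromRows
          ((WeakSec.parityCheck k Ψhat).submatrix (fun r : G' => r.val) id)
          (WeakSec.nodeGenerator k Ψ e)).rank = G'.card + d) := by
  refine ⟨⟨WeakSec.mulVec_surjective_of_linearIndependent
    (WeakSec.linearIndependent_parityCheck hk hkd hΨ), fun g hg e => ?_⟩, fun e G' hG' => ?_⟩
  · rw [WeakSec.nodeContent_eq_mulVec]
    refine WeakSec.weaklySecureAgainst_of_surjective _ _ _ g fun G hG =>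
      WeakSec.mulVec_surjective_of_linearIndependent
        (WeakSec.linearIndependent_parityCheck_nodeGenerator hk hkd hΨ e G (by omega))
  · rw [(WeakSec.linearIndependent_parityCheck_nodeGenerator hk hkd hΨ e G' hG').rank_matrix]
    simp
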